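/- Let $I_0$ be the modified Bessel function, i.e. the solution on $\mathbb R$ of $zI_0''(z)+I_0'(z)-zI_0(z)=0$, $I_0(0)=1$, $I_0'(0)=0$ (this problem has exactly one twice differentiable solution, $I_0(z)=\sum_{k\ge0}\frac{(z/2)^{2k}}{(k!)^2}$), and put $$f(t)=e^{2t}\bigl(I_0(2t)-I_0'(2t)\bigr),\qquad t\in\mathbb R,$$ where $I_0'(2t)$ is the derivative of $I_0$ evaluated at $2t$. Then $f(t)=\sum_{n\ge0}\frac{c_n}{n!}t^n$ for all $t\in\mathbb R$, where $c_n=\frac1{n+1}\binom{2n}{n}$ are the Catalan numbers. Let $w_{-3}=0$, $w_{-2}=w_{-1}=1$ and, for $k\ge0$, $$w_{2k}=\det\bigl(f^{(i+j)}\bigr)_{0\le i,j\le k},\qquad w_{2k+1}=\det\bigl(f^{(i+j+1)}\bigr)_{0\le i,j\le k}.$$ Theorem. For all $n\ge-2$ and $t\in\mathbb R$ one has $w_n(t)\ne0$. On every open interval of $\mathbb R$ containing $0$ (in particular on all of $\mathbb R$), each of the following two Cauchy problems, for sequences of differentiable real functions indexed by $n\ge0$, has exactly one solution: (1) the Volterra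 chain $u_n'=u_n(u_{n+1}-u_{n-1})$, $n\ge0$, with $u_0(0)=0$ and $u_n(0)=1$ for all $n\ge1$; (2) the modified chain $v_n'=v_n^2(v_{n+1}-v_{n-1})$, $n\ge0$, with $v_0(0)=0$ and $v_n(0)=1$ for all $n\ge1$. Here in the equation with $n=0$ the function $u_{-1}$ (respectively $v_{-1}$) is allowed to be any continuous function; its choice does not matter, since $u_0\equiv0$ and $v_0\equiv0$. The solutions are given, for all $n\ge0$, by $$v_n=\frac{w_{n-3}\,w_{n-1}}{w_{n-2}^2},\qquad u_n=\frac{w_{n-3}\,w_n}{w_{n-2}\,w_{n-1}}.$$ -/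

import Mathlib

open scoped Nat

noncomputable section

/-- The modified Bessel function `I₀(z) = ∑ₖ (z/2)^(2k) / (k!)²` on the real line. -/
def besselI0 (z : ℝ) : ℝ := ∑' k : ℕ, (z / 2) ^ (2 * k) / ((k ! : ℝ)) ^ 2

/-- `y` is a twice differentiable solution of the Cauchy problem
`z y'' + y' - z y = 0`, `y(0) = 1`, `y'(0) = 0` on the real line. -/
structure SolvesBesselCauchy (y : ℝ → ℝ) : Prop where
  diff : Differentiable ℝ y
  diff_deriv : Differentiable ℝ (deriv y)
  eqn : ∀ z : ℝ, z * deriv (deriv y) z + deriv y z - z * y z = 0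
  init : y 0 = 1
  init_deriv : deriv y 0 = 0

/-- `f(t) = e^{2t} (I₀(2t) - I₀'(2t))`. -/
def catalanGen (t : ℝ) : ℝ :=
  Real.exp (2 * t) * (besselI0 (2 * t) - deriv besselI0 (2 * t))

/-- The `(k+1) × (k+1)` determinant with entries `f^{(i+j+r)}(t)`, `0 ≤ i, j ≤ k`. -/
def derivHankelDet (f : ℝ → ℝ) (r k : ℕ) (t : ℝ) : ℝ :=
  Matrix.det (Matrix.of fun i j : Fin (k + 1) =>
    iteratedDeriv ((i : ℕ) + (j : ℕ) + r) f t)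

/-- The determinants `w_n`: `w_{2k} = det (f^{(i+j)})` and `w_{2k+1} = det (f^{(i+j+1)})`
with `0 ≤ i, j ≤ k`, together with `w_{-1} = w_{-2} = 1`, `w_{-3} = 0`
(the value `0` for `n < -3` is never used). -/
def chainW (f : ℝ → ℝ) (n : ℤ) (t : ℝ) : ℝ :=
  if n ≤ -3 then 0
  else if n < 0 then 1
  else derivHankelDet f (n.toNat % 2) (n.toNat / 2) t

/-- `(u_n)_{n ≥ 0}` satisfies `u_n' = u_n (u_{n+1} - u_{n-1})` on `I` for all `n ≥ 0`.
The equation for `n = 0` involves the neighbour `u_{-1}`, which is not prescribed by the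
half-line problem: it may be any continuous function `g`. -/
def IsVolterraSolution (I : Set ℝ) (u : ℕ → ℝ → ℝ) : Prop :=
  (∃ g : ℝ → ℝ, ContinuousOn g I ∧
    ∀ t ∈ I, HasDerivAt (u 0) (u 0 t * (u 1 t - g t)) t) ∧
  ∀ n : ℕ, ∀ t ∈ I, HasDerivAt (u (n + 1)) (u (n + 1) t * (u (n + 2) t - u n t)) t

/-- `(v_n)_{n ≥ 0}` satisfies `v_n' = v_n² (v_{n+1} - v_{n-1})` on `I` for all `n ≥ 0`,
where again `v_{-1}` may be any continuous function `g`. -/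
def IsModifiedVolterraSolution (I : Set ℝ) (v : ℕ → ℝ → ℝ) : Prop :=
  (∃ g : ℝ → ℝ, ContinuousOn g I ∧
    ∀ t ∈ I, HasDerivAt (v 0) (v 0 t ^ 2 * (v 1 t - g t)) t) ∧
  ∀ n : ℕ, ∀ t ∈ I, HasDerivAt (v (n + 1)) (v (n + 1) t ^ 2 * (v (n + 2) t - v n t)) t

/-- Step-like initial data: `u_0(0) = 0` and `u_n(0) = 1` for `n ≥ 1`. -/
def HasStepInitialData (u : ℕ → ℝ → ℝ) : Prop :=
  u 0 0 = 0 ∧ ∀ n : ℕ, 1 ≤ n → u n 0 = 1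

end

/-! Put `f' = f u₁`, `f(0) = 1` for a solution of the Volterra chain with `u₀ = 0`. The chain makes
`f⁽ᵐ⁾ / f` the total weight of the Dyck paths of length `2m` in which a down-step from height `j`
weighs `u_j` (`hasDerivAt_mul_ballotArray`). Cutting paths at an intermediate step factors the
Hankel matrices of these moments as `LDLᵀ` (`hankel_det_eq`). Hence `w_n / w_{n-2} = f u₁ ⋯ u_n`,
and the quotient for consecutive `n` is the formula for `u_n`.

Existence: the explicit `f` is the exponential transform of a positive density on `[0, 4]` with
Catalan moments, so every Hankel determinant is positive (`derivHankelDet_catalanGen_pos`). Thus the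
recursion `u_{n+1} = u_n'/u_n + u_{n-1}` never divides by zero (`volterraSeq_ne_zero`).

Uniqueness: the chain is infinite, so it must be shown that the initial data fix `f`. Each `u_n`, `n
≥ 1`, solves a linear equation and stays positive. Therefore all derivatives of `f` are nonnegative,
and at `0` they are the Catalan numbers, which count unweighted Dyck paths. Bernstein's theorem
(`eq_of_hasSum_of_absolutelyMonotone`) says that `f` is the sum of its Taylor series, and `f`
determines all `u_n` by the recursion.

The modified chain reduces to this one through `u_n = v_n v_{n+1}`, with `v₁ = f`. -/

open scoped ContDiff

/-! ### Weighted lattice paths and Hankel determinants -/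

/-- Total weight of the lattice paths with steps `±1` from height `0` to height `k` in `m` steps
staying nonnegative, where a down-step from height `j` has weight `u j`. -/
def ballotArray (u : ℕ → ℝ) : ℕ → ℕ → ℝ
  | 0, 0 => 1
  | 0, _ + 1 => 0
  | m + 1, 0 => u 1 * ballotArray u m 1
  | m + 1, k + 1 => ballotArray u m k + u (k + 2) * ballotArray u m (k + 2)

/-- The product `u 1 * ⋯ * u k`. -/
def weightProd (u : ℕ → ℝ) (k : ℕ) : ℝ := ∏ j ∈ Finset.range k, u (j + 1)

lemma weightProd_succ (u : ℕ → ℝ) (k : ℕ) : weightProd u (k + 1) = weightProd u k * u (k + 1) :=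
  Finset.prod_range_succ _ _

lemma ballotArray_eq_zero_of_lt (u : ℕ → ℝ) {m k : ℕ} (h : m < k) : ballotArray u m k = 0 := by
  induction m generalizing k with
  | zero =>
    obtain ⟨k, rfl⟩ := Nat.exists_eq_add_of_lt h
    simp [ballotArray]
  | succ m ih =>
    obtain _ | k := k
    · omega
    · rw [ballotArray, ih (by omega), ih (by omega)]; simp

lemma ballotArray_self (u : ℕ → ℝ) (m : ℕ) : ballotArray u m m = 1 := by
  induction m with
  | zero => simp [ballotArray]
  | succ m ih => rw [ballotArray, ih, ballotArray_eq_zero_of_lt u (by omega)]; simp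

lemma ballotArray_eq_zero_of_odd (u : ℕ → ℝ) {m k : ℕ} (h : (m + k) % 2 = 1) :
    ballotArray u m k = 0 := by
  induction m generalizing k with
  | zero =>
    obtain _ | k := k
    · omega
    · simp [ballotArray]
  | succ m ih =>
    obtain _ | k := k
    · rw [ballotArray, ih (by omega)]; simp
    · rw [ballotArray, ih (by omega), ih (by omega)]; simp

lemma ballotArray_nonneg {u : ℕ → ℝ} (hu : ∀ n, 0 ≤ u (n + 1)) (m k : ℕ) :
    0 ≤ ballotArray u m k := by
  induction m generalizing k with
  | zero => cases k <;> simp [ballotArray]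
  | succ m ih =>
    obtain _ | k := k
    · exact mul_nonneg (hu 0) (ih _)
    · exact add_nonneg (ih _) (mul_nonneg (hu _) (ih _))

lemma ballotArray_congr {u v : ℕ → ℝ} (h : ∀ n, u (n + 1) = v (n + 1)) (m k : ℕ) :
    ballotArray u m k = ballotArray v m k := by
  induction m generalizing k with
  | zero => cases k <;> simp [ballotArray]
  | succ m ih => cases k <;> simp [ballotArray, ih, h]

/-- The right side is symmetric in `m` and `n`, so a step can be moved from one factor to the other:
the path recursion is self-adjoint for the weight `weightProd u`. -/
lemma sum_ballotArray_shift (u : ℕ → ℝ) {m n N : ℕ} (hm : m ≤ N) :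
    ∑ k ∈ Finset.range (N + 1), ballotArray u (m + 1) k * ballotArray u n k * weightProd u k =
      ∑ k ∈ Finset.range N, (ballotArray u m k * ballotArray u n (k + 1) +
        ballotArray u m (k + 1) * ballotArray u n k) * weightProd u (k + 1) := by
  have h1 : ∀ k, ballotArray u (m + 1) (k + 1) * ballotArray u n (k + 1) * weightProd u (k + 1) =
      ballotArray u m k * ballotArray u n (k + 1) * weightProd u (k + 1) +
        ballotArray u m (k + 2) * ballotArray u n (k + 1) * weightProd u (k + 2) := by
    intro k
    rw [ballotArray, weightProd_succ u (k + 1)]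
    ring
  have h2 : ballotArray u (m + 1) 0 * ballotArray u n 0 * weightProd u 0 =
      ballotArray u m 1 * ballotArray u n 0 * weightProd u 1 := by
    simp [ballotArray, weightProd]
    ring
  rw [Finset.sum_range_succ', Finset.sum_congr rfl fun k _ => h1 k, h2, Finset.sum_add_distrib,
    add_assoc, ← Finset.sum_range_succ' (fun k =>
      ballotArray u m (k + 1) * ballotArray u n k * weightProd u (k + 1)) N,
    Finset.sum_range_succ, ballotArray_eq_zero_of_lt u (show m < N + 1 by omega)]
  simp only [add_mul, Finset.sum_add_distrib]
  ring

/-- Cut a closed path after `m` steps, at height `k`, and reverse the second piece; `weightProd u k`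
restores the weights of its `k` unmatched down-steps. The generous range `N` stays fixed while steps
pass from one factor to the other. -/
lemma ballotArray_add_of_le (u : ℕ → ℝ) (m n : ℕ) {N : ℕ} (h : m + n ≤ N) :
    ballotArray u (m + n) 0 =
      ∑ k ∈ Finset.range (N + 1), ballotArray u m k * ballotArray u n k * weightProd u k := by
  induction n generalizing m with
  | zero =>
    rw [Finset.sum_eq_single 0]
    · simp [ballotArray, weightProd]
    · intro k _ hk
      obtain ⟨k, rfl⟩ := Nat.exists_eq_succ_of_ne_zero hk
      simp [ballotArray]
    · simp
  | succ n ih =>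
    rw [show m + (n + 1) = m + 1 + n by ring, ih (m + 1) (by omega),
      sum_ballotArray_shift u (by omega : m ≤ N)]
    rw [Finset.sum_congr rfl fun k _ => show ballotArray u m k * ballotArray u (n + 1) k *
        weightProd u k = ballotArray u (n + 1) k * ballotArray u m k * weightProd u k by ring,
      sum_ballotArray_shift u (by omega : n ≤ N)]
    exact Finset.sum_congr rfl fun k _ => by ring

lemma ballotArray_add (u : ℕ → ℝ) (m n : ℕ) {N : ℕ} (h : m < N) :
    ballotArray u (m + n) 0 =
      ∑ k ∈ Finset.range N, ballotArray u m k * ballotArray u n k * weightProd u k := by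
  rw [ballotArray_add_of_le u m n (N := N + (m + n)) (by omega)]
  symm
  apply Finset.sum_subset
  · intro k; simp only [Finset.mem_range]; omega
  · intro k _ hk
    rw [ballotArray_eq_zero_of_lt u (show m < k by simp only [Finset.mem_range] at hk; omega)]
    simp

lemma sum_range_two_mul (g : ℕ → ℝ) (n : ℕ) :
    ∑ k ∈ Finset.range (2 * n), g k = ∑ l ∈ Finset.range n, (g (2 * l) + g (2 * l + 1)) := by
  induction n with
  | zero => simp
  | succ n ih =>
    rw [show 2 * (n + 1) = 2 * n + 1 + 1 by ring, Finset.sum_range_succ, Finset.sum_range_succ, ih,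
      Finset.sum_range_succ, add_assoc]

/-- `LDLᵀ` factorization of Hankel determinants of the moments `c * ballotArray u (2 * m) 0`. -/
lemma hankel_det_eq {u : ℕ → ℝ} {c : ℝ} {s : ℕ → ℝ} {r K : ℕ} (hr : r < 2)
    (hs : ∀ m ≤ 2 * K + r, s m = c * ballotArray u (2 * m) 0) :
    Matrix.det (Matrix.of fun i j : Fin (K + 1) => s ((i : ℕ) + (j : ℕ) + r)) =
      ∏ l ∈ Finset.range (K + 1), (c * weightProd u (2 * l + r)) := by
  let P : Matrix (Fin (K + 1)) (Fin (K + 1)) ℝ :=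
    Matrix.of fun i l => ballotArray u (2 * i + r) (2 * l + r)
  have hP : P.det = 1 := by
    rw [Matrix.det_of_isLowerTriangular]
    · simp [P, ballotArray_self]
    · intro i j hij
      have : (i : ℕ) < j := hij
      exact ballotArray_eq_zero_of_lt u (by omega)
  have hfac : (Matrix.of fun i j : Fin (K + 1) => s ((i : ℕ) + (j : ℕ) + r)) =
      P * Matrix.diagonal (fun l : Fin (K + 1) => c * weightProd u (2 * l + r)) * P.transpose := by
    ext i j
    rw [Matrix.mul_apply]
    simp only [Matrix.mul_diagonal, Matrix.transpose_apply, Matrix.of_apply, P]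
    rw [hs _ (by omega), show 2 * ((i : ℕ) + j + r) = (2 * i + r) + (2 * j + r) by ring,
      ballotArray_add u _ _ (show 2 * (i : ℕ) + r < 2 * (K + 1) by omega), sum_range_two_mul,
      Finset.mul_sum, ← Fin.sum_univ_eq_sum_range
        (fun l => c * (ballotArray u (2 * i + r) (2 * l) * ballotArray u (2 * j + r) (2 * l) *
          weightProd u (2 * l) + ballotArray u (2 * i + r) (2 * l + 1) *
          ballotArray u (2 * j + r) (2 * l + 1) * weightProd u (2 * l + 1)))]
    refine Finset.sum_congr rfl fun l _ => ?_
    -- By parity only heights congruent to `r` modulo 2 contribute.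
    interval_cases r
    · rw [ballotArray_eq_zero_of_odd u (show (2 * (i : ℕ) + 0 + (2 * l + 1)) % 2 = 1 by omega)]
      ring_nf
    · rw [ballotArray_eq_zero_of_odd u (show (2 * (i : ℕ) + 1 + (2 * l)) % 2 = 1 by omega)]
      ring_nf
  rw [hfac, Matrix.det_mul, Matrix.det_mul, Matrix.det_transpose, hP, Matrix.det_diagonal,
    Fin.prod_univ_eq_prod_range (fun l => c * weightProd u (2 * l + r))]
  simp

/-- The ballot numbers, with `j` counting down-steps: removing a final up-step leads to `(k - 1,
j)`, removing a final down-step to `(k + 1, j - 1)`. -/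
lemma ballotArray_one (k j : ℕ) :
    ballotArray (fun _ => 1) (k + 2 * j) k =
      (k + 1) * ((k + 2 * j) ! : ℝ) / (((k + j + 1) ! : ℝ) * (j ! : ℝ)) := by
  induction hm : k + 2 * j generalizing k j with
  | zero =>
    obtain ⟨rfl, rfl⟩ : k = 0 ∧ j = 0 := by omega
    simp [ballotArray]
  | succ m ih =>
    obtain _ | k := k
    · obtain _ | j := j
      · omega
      have h := ih 1 j (by omega)
      obtain rfl : m = 2 * j + 1 := by omega
      rw [ballotArray, h]
      simp only [show 1 + j + 1 = j + 2 by ring, show 0 + (j + 1) + 1 = j + 2 by ring,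
        Nat.factorial_succ j, Nat.factorial_succ (2 * j + 1)]
      push_cast
      field_simp
      ring
    · have h1 := ih k j (by omega)
      rw [ballotArray, h1]
      obtain _ | j := j
      · rw [ballotArray_eq_zero_of_lt _ (by omega)]
        obtain rfl : m = k := by omega
        simp only [Nat.factorial_succ, add_zero]
        push_cast
        field_simp
        ring
      · rw [ih (k + 2) j (by omega)]
        obtain rfl : m = k + 2 * j + 2 := by omega
        simp only [show k + 2 + j + 1 = k + j + 3 by ring, show k + (j + 1) + 1 = k + j + 2 by ring,
          show k + 1 + (j + 1) + 1 = k + j + 3 by ring,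
          Nat.factorial_succ j, Nat.factorial_succ (k + 2 * j + 2), Nat.factorial_succ (k + j + 2)]
        push_cast
        field_simp
        ring

lemma ballotArray_one_eq_catalan (n : ℕ) :
    ballotArray (fun _ => 1) (2 * n) 0 = catalan n := by
  have h := ballotArray_one 0 n
  have h2 : ((n + 1 : ℕ) : ℝ) * catalan n = (n.centralBinom : ℕ) := by
    exact_mod_cast succ_mul_catalan_eq_centralBinom n
  have h3 : (n.centralBinom : ℝ) * (n ! : ℝ) * (n ! : ℝ) = ((2 * n) ! : ℝ) := by
    have := Nat.choose_mul_factorial_mul_factorial (show n ≤ 2 * n by omega)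
    rw [show 2 * n - n = n by omega, ← Nat.centralBinom_eq_two_mul_choose] at this
    exact_mod_cast this
  simp only [zero_add] at h
  rw [h, ← h3, ← h2, Nat.factorial_succ]
  push_cast
  field_simp
  simp

/-! ### The Volterra flow on path weights -/

/-- The Volterra equations for indices `1, …, N` propagate to the weighted path counts. -/
lemma hasDerivAt_ballotArray {u : ℕ → ℝ → ℝ} {t : ℝ} {N : ℕ} (h0 : u 0 t = 0)
    (hu : ∀ n < N, HasDerivAt (u (n + 1)) (u (n + 1) t * (u (n + 2) t - u n t)) t)
    (m k : ℕ) (hmk : m + k ≤ 2 * N) :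
    HasDerivAt (fun x => ballotArray (fun n => u n x) m k)
      (u (k + 1) t * u (k + 2) t * ballotArray (fun n => u n t) m (k + 2)) t := by
  induction m generalizing k with
  | zero =>
    obtain _ | k := k
    · simpa [ballotArray] using hasDerivAt_const t (1 : ℝ)
    · simpa [ballotArray] using hasDerivAt_const t (0 : ℝ)
  | succ m ih =>
    obtain _ | k := k
    · simp only [ballotArray]
      refine ((hu 0 (by omega)).mul (ih 1 (by omega))).congr_deriv ?_
      simp only [zero_add, h0]
      ring
    · simp only [ballotArray]
      by_cases hk : k + 1 < N
      · refine ((ih k (by omega)).add ((hu (k + 1) hk).mul (ih (k + 2) (by omega)))).congr_deriv ?_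
        simp only [add_assoc, Nat.reduceAdd]
        ring
      -- At the truncation level the height `k + 2` exceeds the number `m` of steps, so the term
      -- whose equation is not assumed vanishes identically.
      · have hz : ∀ x, ballotArray (fun n => u n x) m (k + 2) = 0 :=
          fun x => ballotArray_eq_zero_of_lt _ (by omega)
        simp only [hz, mul_zero, add_zero]
        refine (ih k (by omega)).congr_deriv ?_
        rw [hz, ballotArray_eq_zero_of_lt _ (show m < k + 2 + 2 by omega)]
        ring

/-- The product rule yields `f u₁ (A(2m,0) + u₂ A(2m,2))`, which is the recursion for the paths two
steps longer. A finite `N` is kept because the chain is later available only up to a given index. -/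
lemma hasDerivAt_mul_ballotArray {u : ℕ → ℝ → ℝ} {f : ℝ → ℝ} {t : ℝ} {N m : ℕ} (h0 : u 0 t = 0)
    (hf : HasDerivAt f (f t * u 1 t) t)
    (hu : ∀ n < N, HasDerivAt (u (n + 1)) (u (n + 1) t * (u (n + 2) t - u n t)) t) (hm : m ≤ N) :
    HasDerivAt (fun x => f x * ballotArray (fun n => u n x) (2 * m) 0)
      (f t * ballotArray (fun n => u n t) (2 * (m + 1)) 0) t := by
  refine (hf.mul (hasDerivAt_ballotArray h0 hu (2 * m) 0 (by omega))).congr_deriv ?_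
  rw [show 2 * (m + 1) = 2 * m + 1 + 1 by ring]
  simp only [ballotArray]
  ring

/-! ### Exponential integrals and the Bessel function -/

open Real in
lemma hasDerivAt_integral_mul_exp {a b : ℝ → ℝ} (ha : Continuous a) (hb : Continuous b) {A B : ℝ}
    (hA : ∀ x, |a x| ≤ A) (hB : ∀ x, |b x| ≤ B) (c d t : ℝ) :
    HasDerivAt (fun t => ∫ x in c..d, b x * exp (t * a x))
      (∫ x in c..d, b x * a x * exp (t * a x)) t := by
  refine (intervalIntegral.hasDerivAt_integral_of_dominated_loc_of_deriv_le
    (F := fun t x => b x * exp (t * a x)) (F' := fun t x => b x * a x * exp (t * a x))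
    (bound := fun _ => B * A * exp ((|t| + 1) * A)) (Metric.ball_mem_nhds t one_pos)
    (.of_forall fun s => (by fun_prop : Continuous _).aestronglyMeasurable)
    (Continuous.intervalIntegrable (by fun_prop) _ _)
    (by fun_prop : Continuous _).aestronglyMeasurable
    ?_ intervalIntegrable_const ?_).2
  · refine .of_forall fun x _ s hs => ?_
    have hA0 : 0 ≤ A := (abs_nonneg _).trans (hA 0)
    have hB0 : 0 ≤ B := (abs_nonneg _).trans (hB 0)
    have hs' : |s| ≤ |t| + 1 := by
      rw [Metric.mem_ball, Real.dist_eq] at hs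
      linarith [abs_sub_abs_le_abs_sub s t]
    rw [Real.norm_eq_abs, abs_mul, abs_mul, abs_of_pos (exp_pos _)]
    have : s * a x ≤ (|t| + 1) * A := by
      refine (le_abs_self _).trans ?_
      rw [abs_mul]
      exact mul_le_mul hs' (hA x) (abs_nonneg _) (by positivity)
    gcongr
    · exact hB x
    · exact hA x
  · refine .of_forall fun x _ s _ => ?_
    refine (((hasDerivAt_id s).mul_const (a x)).exp.const_mul (b x)).congr_deriv ?_
    simp
    ring

open Real in
lemma hasSum_integral_mul_exp {a b : ℝ → ℝ} (ha : Continuous a) (hb : Continuous b) {A B : ℝ}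
    (hA : ∀ x, |a x| ≤ A) (hB : ∀ x, |b x| ≤ B) (c d t : ℝ) :
    HasSum (fun n : ℕ => (∫ x in c..d, b x * a x ^ n) / (n ! : ℝ) * t ^ n)
      (∫ x in c..d, b x * exp (t * a x)) := by
  have h : ∀ x, HasSum (fun n : ℕ => b x * ((t * a x) ^ n / (n ! : ℝ))) (b x * exp (t * a x)) := by
    intro x
    refine HasSum.mul_left _ ?_
    rw [Real.exp_eq_exp_ℝ]
    exact NormedSpace.expSeries_div_hasSum_exp (t * a x)
  have hs : Summable fun n : ℕ => B * ((|t| * A) ^ n / (n ! : ℝ)) :=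
    (Real.summable_pow_div_factorial _).mul_left _
  have := intervalIntegral.hasSum_integral_of_dominated_convergence (μ := MeasureTheory.volume)
    (a := c) (b := d)
    (F := fun n x => b x * ((t * a x) ^ n / (n ! : ℝ))) (f := fun x => b x * exp (t * a x))
    (fun n _ => B * ((|t| * A) ^ n / (n ! : ℝ)))
    (fun n => (by fun_prop : Continuous _).aestronglyMeasurable)
    (fun n => .of_forall fun x _ => by
      have hA0 : 0 ≤ A := (abs_nonneg _).trans (hA 0)
      have hB0 : 0 ≤ B := (abs_nonneg _).trans (hB 0)
      rw [Real.norm_eq_abs, abs_mul, abs_div, abs_pow, abs_mul, Nat.abs_cast]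
      gcongr
      · exact hB x
      · exact hA x)
    (.of_forall fun x _ => hs) intervalIntegrable_const (.of_forall fun x _ => h x)
  refine this.congr_fun fun n => ?_
  rw [div_mul_eq_mul_div, mul_div_assoc, ← intervalIntegral.integral_mul_const]
  exact intervalIntegral.integral_congr fun x _ => by ring

open Real in
lemma abs_inv_pi_le (x : ℝ) : |(fun _ : ℝ => 1 / π) x| ≤ 1 := by
  simp only
  rw [abs_of_pos (by positivity), div_le_one pi_pos]
  linarith [two_le_pi]

open Real in
lemma cos_moment_even (k : ℕ) :
    ∫ x in (0 : ℝ)..π, 1 / π * cos x ^ (2 * k) = ((2 * k) ! : ℝ) / (4 ^ k * (k ! : ℝ) ^ 2) := by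
  induction k with
  | zero => simp [pi_ne_zero]
  | succ k ih =>
    rw [intervalIntegral.integral_const_mul] at ih ⊢
    rw [show 2 * (k + 1) = 2 * k + 2 by ring, integral_cos_pow, sin_pi, sin_zero, mul_add,
      mul_left_comm, ih, Nat.factorial_succ, Nat.factorial_succ, Nat.factorial_succ]
    push_cast
    field_simp
    ring

open Real in
lemma cos_moment_odd (k : ℕ) :
    ∫ x in (0 : ℝ)..π, 1 / π * cos x ^ (2 * k + 1) = 0 := by
  rw [intervalIntegral.integral_const_mul]
  induction k with
  | zero => simp
  | succ k ih =>
    rw [show 2 * (k + 1) + 1 = 2 * k + 1 + 2 by ring, integral_cos_pow, sin_pi, sin_zero, mul_add,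
      mul_left_comm, ih]
    simp

open Real in
lemma besselI0_eq_integral (z : ℝ) :
    besselI0 z = ∫ x in (0 : ℝ)..π, 1 / π * exp (z * cos x) := by
  have h := hasSum_integral_mul_exp (a := cos) (b := fun _ => 1 / π) continuous_cos
    continuous_const abs_cos_le_one abs_inv_pi_le 0 π z
  -- The odd cosine moments vanish, so the series lives on even exponents.
  have hinj : Function.Injective fun k : ℕ => 2 * k := fun a b h => by simpa using h
  rw [← hinj.hasSum_iff] at h
  · refine (h.congr_fun fun k => ?_).tsum_eq
    have : ((2 * k) ! : ℝ) ≠ 0 := by positivity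
    rw [Function.comp, cos_moment_even, div_pow, pow_mul 2 2 k]
    field_simp
    norm_num
  · intro n hn
    obtain ⟨k, rfl⟩ : ∃ k, n = 2 * k + 1 := by
      obtain ⟨k, h | h⟩ := Nat.even_or_odd' n
      · exact absurd ⟨_, h.symm⟩ hn
      · exact ⟨_, h⟩
    rw [cos_moment_odd]
    simp

open Real in
lemma hasDerivAt_besselI0 (z : ℝ) :
    HasDerivAt besselI0 (∫ x in (0 : ℝ)..π, 1 / π * cos x * exp (z * cos x)) z := by
  rw [show besselI0 = _ from funext besselI0_eq_integral]
  exact hasDerivAt_integral_mul_exp (a := cos) (b := fun _ => 1 / π) continuous_cos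
    continuous_const abs_cos_le_one abs_inv_pi_le 0 π z

open Real in
lemma deriv_besselI0 :
    deriv besselI0 = fun z => ∫ x in (0 : ℝ)..π, 1 / π * cos x * exp (z * cos x) :=
  funext fun z => (hasDerivAt_besselI0 z).deriv

open Real in
lemma hasDerivAt_deriv_besselI0 (z : ℝ) :
    HasDerivAt (deriv besselI0)
      (∫ x in (0 : ℝ)..π, 1 / π * cos x * cos x * exp (z * cos x)) z := by
  rw [deriv_besselI0]
  refine hasDerivAt_integral_mul_exp (a := cos) (b := fun x => 1 / π * cos x) (A := 1) (B := 1)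
    continuous_cos (by fun_prop) abs_cos_le_one (fun x => ?_) 0 π z
  rw [abs_mul]
  exact mul_le_one₀ (abs_inv_pi_le x) (abs_nonneg _) (abs_cos_le_one x)

open Real in
lemma solvesBesselCauchy_besselI0 : SolvesBesselCauchy besselI0 where
  diff z := (hasDerivAt_besselI0 z).differentiableAt
  diff_deriv z := (hasDerivAt_deriv_besselI0 z).differentiableAt
  eqn z := by
    rw [(hasDerivAt_deriv_besselI0 z).deriv, (hasDerivAt_besselI0 z).deriv, besselI0_eq_integral,
      ← intervalIntegral.integral_const_mul, ← intervalIntegral.integral_const_mul,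
      ← intervalIntegral.integral_add (Continuous.intervalIntegrable (by fun_prop) _ _)
        (Continuous.intervalIntegrable (by fun_prop) _ _),
      ← intervalIntegral.integral_sub (Continuous.intervalIntegrable (by fun_prop) _ _)
        (Continuous.intervalIntegrable (by fun_prop) _ _),
      -- The integrand, a multiple of `z cos² x + cos x - z = cos x - z sin² x`, is an exact
      -- derivative whose primitive vanishes at `0` and `π`.
      intervalIntegral.integral_eq_sub_of_hasDerivAt
        (f := fun x => 1 / π * (sin x * exp (z * cos x)))
        _ (Continuous.intervalIntegrable (by fun_prop) _ _)]
    · simp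
    · intro x _
      refine (((hasDerivAt_sin x).mul ((hasDerivAt_cos x).const_mul z).exp).const_mul
        (1 / π)).congr_deriv ?_
      linear_combination (- z / π * exp (z * cos x)) * sin_sq_add_cos_sq x
  init := by simp [besselI0_eq_integral, pi_ne_zero]
  init_deriv := by simp [deriv_besselI0]

/-- The equation is singular at `0`, so an energy replaces the standard uniqueness theorem: `d² -
d'²` has derivative `2 d'² / x ≥ 0`, whence `|d'| ≤ |d|` and Grönwall applies. -/
lemma eq_zero_of_bessel_of_nonneg {d e e' : ℝ → ℝ} (hd : ∀ z, HasDerivAt d (e z) z)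
    (he : ∀ z, HasDerivAt e (e' z) z) (heq : ∀ z, z * e' z + e z - z * d z = 0)
    (hd0 : d 0 = 0) (he0 : e 0 = 0) {z : ℝ} (hz : 0 ≤ z) : d z = 0 := by
  have hbound : ∀ x, 0 ≤ x → e x ^ 2 ≤ d x ^ 2 := by
    have hE : ∀ x, HasDerivAt (fun x => d x ^ 2 - e x ^ 2) (2 * d x * e x - 2 * e x * e' x) x := by
      intro x
      refine (((hd x).pow 2).sub ((he x).pow 2)).congr_deriv ?_
      simp
    have hmono : MonotoneOn (fun x => d x ^ 2 - e x ^ 2) (Set.Ici 0) := by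
      refine monotoneOn_of_deriv_nonneg (convex_Ici 0)
        (fun x _ => (hE x).continuousAt.continuousWithinAt)
        (fun x _ => (hE x).differentiableAt.differentiableWithinAt) fun x hx => ?_
      rw [interior_Ici, Set.mem_Ioi] at hx
      rw [(hE x).deriv, show e' x = d x - e x / x by
        field_simp
        linear_combination heq x]
      have : 0 ≤ 2 * (e x ^ 2 / x) := by positivity
      linear_combination this
    intro x hx
    have := hmono (Set.mem_Ici.2 le_rfl) (Set.mem_Ici.2 hx) hx
    simp only [hd0, he0] at this
    linarith
  exact eq_zero_of_abs_deriv_le_mul_abs_self_of_eq_zero_right (K := 1) (a := 0) (b := z)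
    (fun x _ => (hd x).continuousAt.continuousWithinAt) (fun x _ => (hd x).hasDerivWithinAt) hd0
    (fun x hx => by
      rw [one_mul]
      exact sq_le_sq.1 (hbound x hx.1)) z ⟨hz, le_rfl⟩

lemma eq_zero_of_bessel {d e e' : ℝ → ℝ} (hd : ∀ z, HasDerivAt d (e z) z)
    (he : ∀ z, HasDerivAt e (e' z) z) (heq : ∀ z, z * e' z + e z - z * d z = 0)
    (hd0 : d 0 = 0) (he0 : e 0 = 0) (z : ℝ) : d z = 0 := by
  obtain hz | hz := le_total 0 z
  · exact eq_zero_of_bessel_of_nonneg hd he heq hd0 he0 hz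
  · have := eq_zero_of_bessel_of_nonneg (d := fun x => d (-x)) (e := fun x => -e (-x))
      (e' := fun x => e' (-x)) (z := -z)
      (fun x => by simpa [Function.comp_def] using (hd (-x)).scomp x (hasDerivAt_neg x))
      (fun x => by
        simpa [Function.comp_def, Pi.neg_def] using ((he (-x)).scomp x (hasDerivAt_neg x)).neg)
      (fun x => by linear_combination -heq (-x)) (by simpa) (by simpa) (by linarith)
    simpa using this

theorem solvesBesselCauchy_iff (y : ℝ → ℝ) : SolvesBesselCauchy y ↔ y = besselI0 := by
  refine ⟨fun hy => ?_, fun h => h ▸ solvesBesselCauchy_besselI0⟩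
  have hB := solvesBesselCauchy_besselI0
  ext z
  refine sub_eq_zero.1 (eq_zero_of_bessel (d := fun z => y z - besselI0 z)
    (fun x => (hy.diff x).hasDerivAt.sub (hB.diff x).hasDerivAt)
    (fun x => (hy.diff_deriv x).hasDerivAt.sub (hB.diff_deriv x).hasDerivAt)
    (fun x => by linear_combination hy.eqn x - hB.eqn x)
    (by simp [hy.init, hB.init]) (by simp [hy.init_deriv, hB.init_deriv]) z)

/-! ### Integral representation of `f`, Catalan moments and positivity -/

open Real in
lemma catalanGen_eq_integral (t : ℝ) :
    catalanGen t = ∫ x in (0 : ℝ)..π, (1 - cos x) / π * exp (t * (2 + 2 * cos x)) := by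
  rw [catalanGen, besselI0_eq_integral, deriv_besselI0, ← intervalIntegral.integral_sub
    (Continuous.intervalIntegrable (by fun_prop) _ _)
    (Continuous.intervalIntegrable (by fun_prop) _ _), ← intervalIntegral.integral_const_mul]
  refine intervalIntegral.integral_congr fun x _ => ?_
  rw [show t * (2 + 2 * cos x) = 2 * t + 2 * t * cos x by ring, exp_add]
  ring

open Real in
lemma abs_two_add_two_mul_cos_le (x : ℝ) : |2 + 2 * cos x| ≤ 4 := by
  rw [abs_le]
  constructor <;> linarith [neg_one_le_cos x, cos_le_one x]

open Real in
lemma catalan_moment (n : ℕ) :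
    ∫ x in (0 : ℝ)..π, (1 - cos x) / π * (2 + 2 * cos x) ^ n = catalan n := by
  induction n with
  | zero =>
    simp only [pow_zero, mul_one, intervalIntegral.integral_div]
    rw [intervalIntegral.integral_sub intervalIntegrable_const
      (Continuous.intervalIntegrable (by fun_prop) _ _)]
    simp [pi_ne_zero]
  | succ n ih =>
    -- Integrating the derivative of `sin x (1 - cos x) (2 + 2 cos x)ⁿ / π` gives the Catalan
    -- recurrence `(n + 2) c_{n+1} = 2 (2n + 1) c_n`.
    have h1 : ∫ x in (0 : ℝ)..π, ((n + 2) / 2 * ((1 - cos x) / π * (2 + 2 * cos x) ^ (n + 1)) -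
        (2 * n + 1) * ((1 - cos x) / π * (2 + 2 * cos x) ^ n)) = 0 := by
      rw [intervalIntegral.integral_eq_sub_of_hasDerivAt
        (f := fun x => 1 / π * (sin x * ((1 - cos x) * (2 + 2 * cos x) ^ n)))
        _ (Continuous.intervalIntegrable (by fun_prop) _ _)]
      · simp
      · intro x _
        have hy : HasDerivAt (fun x => 2 + 2 * cos x) (2 * -sin x) x :=
          ((hasDerivAt_cos x).const_mul 2).const_add 2
        have hc : HasDerivAt (fun x => 1 - cos x) (sin x) x := by
          simpa using (hasDerivAt_cos x).const_sub 1
        refine (((hasDerivAt_sin x).mul (hc.mul (hy.pow n))).const_mul (1 / π)).congr_deriv ?_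
        have hn : (n : ℝ) * (2 + 2 * cos x) ^ n =
            n * (2 + 2 * cos x) ^ (n - 1) * (2 + 2 * cos x) := by
          obtain _ | n := n
          · simp
          · simp [pow_succ, mul_assoc]
        have hs : sin x ^ 2 = (1 - cos x) * (1 + cos x) := by
          linear_combination sin_sq_add_cos_sq x
        simp only [Pi.mul_apply, Pi.pow_apply]
        linear_combination (1 / π) * (((2 + 2 * cos x) ^ n -
          2 * (1 - cos x) * (n * (2 + 2 * cos x) ^ (n - 1))) * hs + (1 - cos x) ^ 2 * hn)
    rw [intervalIntegral.integral_sub (Continuous.intervalIntegrable (by fun_prop) _ _)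
      (Continuous.intervalIntegrable (by fun_prop) _ _), intervalIntegral.integral_const_mul,
      intervalIntegral.integral_const_mul, ih] at h1
    have h2 : ((n + 1 : ℕ) : ℝ) * catalan n = (n.centralBinom : ℕ) := by
      exact_mod_cast succ_mul_catalan_eq_centralBinom n
    have h3 : ((n + 1 + 1 : ℕ) : ℝ) * catalan (n + 1) = ((n + 1).centralBinom : ℕ) := by
      exact_mod_cast succ_mul_catalan_eq_centralBinom (n + 1)
    have h4 : ((n + 1 : ℕ) : ℝ) * (n + 1).centralBinom = 2 * (2 * n + 1) * n.centralBinom := by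
      exact_mod_cast Nat.succ_mul_centralBinom_succ n
    push_cast at h2 h3 h4
    have h5 : ((n : ℝ) + 1) * (n + 2) ≠ 0 := by positivity
    refine mul_left_cancel₀ h5 ?_
    linear_combination 2 * (n + 1) * h1 - (n + 1) * h3 - h4 + 2 * (2 * n + 1) * h2

lemma abs_one_sub_cos_div_pi_le (x : ℝ) : |(1 - Real.cos x) / Real.pi| ≤ 2 := by
  rw [abs_div, abs_of_pos Real.pi_pos, div_le_iff₀ Real.pi_pos, abs_le]
  constructor <;> nlinarith [Real.neg_one_le_cos x, Real.cos_le_one x, Real.two_le_pi]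

theorem hasSum_catalanGen (t : ℝ) :
    HasSum (fun n : ℕ => (catalan n : ℝ) / (n ! : ℝ) * t ^ n) (catalanGen t) := by
  have h := hasSum_integral_mul_exp (a := fun x => 2 + 2 * Real.cos x) (A := 4) (B := 2)
    (b := fun x => (1 - Real.cos x) / Real.pi) (by fun_prop) (by fun_prop)
    abs_two_add_two_mul_cos_le abs_one_sub_cos_div_pi_le 0 Real.pi t
  simp only [catalan_moment] at h
  rwa [catalanGen_eq_integral]

open Real in
lemma hasDerivAt_catalan_integral (m : ℕ) (t : ℝ) :
    HasDerivAt (fun t => ∫ x in (0 : ℝ)..π,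
        (1 - cos x) / π * (2 + 2 * cos x) ^ m * exp (t * (2 + 2 * cos x)))
      (∫ x in (0 : ℝ)..π,
        (1 - cos x) / π * (2 + 2 * cos x) ^ (m + 1) * exp (t * (2 + 2 * cos x))) t := by
  refine (hasDerivAt_integral_mul_exp (a := fun x => 2 + 2 * cos x) (A := 4) (B := 2 * 4 ^ m)
    (b := fun x => (1 - cos x) / π * (2 + 2 * cos x) ^ m) (by fun_prop) (by fun_prop)
    abs_two_add_two_mul_cos_le (fun x => ?_) 0 π t).congr_deriv ?_
  · rw [abs_mul, abs_pow]
    exact mul_le_mul (abs_one_sub_cos_div_pi_le x)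
      (pow_le_pow_left₀ (abs_nonneg _) (abs_two_add_two_mul_cos_le x) m)
      (by positivity) (by norm_num)
  · exact intervalIntegral.integral_congr fun x _ => by ring

open Real in
lemma iteratedDeriv_catalanGen (m : ℕ) :
    iteratedDeriv m catalanGen = fun t => ∫ x in (0 : ℝ)..π,
      (1 - cos x) / π * (2 + 2 * cos x) ^ m * exp (t * (2 + 2 * cos x)) := by
  induction m with
  | zero => simp [funext catalanGen_eq_integral]
  | succ m ih =>
    rw [iteratedDeriv_succ, ih, funext fun t => (hasDerivAt_catalan_integral m t).deriv]

-- The quadratic form of the Hankel matrix at `c` is the integral of `p(2 + 2 cos x)²` against a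
-- nonnegative density, where `p` has coefficients `c`.
open Real Matrix in
theorem derivHankelDet_catalanGen_pos (r K : ℕ) (t : ℝ) : 0 < derivHankelDet catalanGen r K t := by
  refine Matrix.PosDef.det_pos (Matrix.PosDef.of_dotProduct_mulVec_pos ?_ fun c hc => ?_)
  · ext i j
    simp [add_comm (i : ℕ) j]
  · have hform : star c ⬝ᵥ (Matrix.of fun i j : Fin (K + 1) =>
        iteratedDeriv ((i : ℕ) + (j : ℕ) + r) catalanGen t) *ᵥ c = ∫ x in (0 : ℝ)..π,
          (1 - cos x) / π * (2 + 2 * cos x) ^ r * exp (t * (2 + 2 * cos x)) *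
            (∑ i, c i * (2 + 2 * cos x) ^ (i : ℕ)) ^ 2 := by
      have hexp : ∀ x, (1 - cos x) / π * (2 + 2 * cos x) ^ r * exp (t * (2 + 2 * cos x)) *
            (∑ i, c i * (2 + 2 * cos x) ^ (i : ℕ)) ^ 2 =
              ∑ i : Fin (K + 1), ∑ j : Fin (K + 1), c i * ((1 - cos x) / π *
              (2 + 2 * cos x) ^ ((i : ℕ) + (j : ℕ) + r) * exp (t * (2 + 2 * cos x)) * c j) := by
        intro x
        rw [sq, Finset.sum_mul_sum, Finset.mul_sum]
        refine Finset.sum_congr rfl fun i _ => ?_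
        rw [Finset.mul_sum]
        refine Finset.sum_congr rfl fun j _ => ?_
        ring
      simp only [hexp]
      rw [intervalIntegral.integral_finsetSum fun i _ =>
        Continuous.intervalIntegrable (by fun_prop) _ _]
      simp only [dotProduct, Matrix.mulVec, iteratedDeriv_catalanGen, Matrix.of_apply,
        Finset.mul_sum, Pi.star_apply, star_trivial]
      refine Finset.sum_congr rfl fun i _ => ?_
      rw [intervalIntegral.integral_finsetSum fun i _ =>
        Continuous.intervalIntegrable (by fun_prop) _ _]
      refine Finset.sum_congr rfl fun j _ => ?_
      rw [intervalIntegral.integral_const_mul, intervalIntegral.integral_mul_const]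
    rw [hform]
    have hcos : ∀ x, 0 ≤ 2 + 2 * cos x := fun x => by linarith [neg_one_le_cos x]
    have hcos' : ∀ x, 0 ≤ 1 - cos x := fun x => by linarith [cos_le_one x]
    refine intervalIntegral.integral_pos pi_pos (by fun_prop) (fun x _ => ?_) ?_
    · have := hcos x
      have := hcos' x
      positivity
    let p : Polynomial ℝ := ∑ i : Fin (K + 1), Polynomial.monomial (i : ℕ) (c i)
    have hp : p ≠ 0 := by
      obtain ⟨i, hi⟩ := Function.ne_iff.1 hc
      refine fun h0 => hi ?_
      have := congrArg (fun q => q.coeff (i : ℕ)) h0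
      simpa [p, Polynomial.finsetSum_coeff, Polynomial.coeff_monomial, Fin.val_inj] using this
    have hpe : ∀ y, p.eval y = ∑ i, c i * y ^ (i : ℕ) := by
      intro y
      simp [p, Polynomial.eval_finsetSum]
    -- A nonzero `p` has finitely many roots, so some `y` in `(0, 4)` is not one; there the density
    -- is positive too, and `y = 2 + 2 cos x` is solved for `x`.
    obtain ⟨y, ⟨hy0, hy4⟩, hy⟩ := ((Set.Ioo_infinite (show (0 : ℝ) < 4 by norm_num)).sdiff
      p.roots.toFinset.finite_toSet).nonempty
    have hyp : p.eval y ≠ 0 := by simpa [hp] using hy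
    refine ⟨arccos ((y - 2) / 2), ⟨arccos_nonneg _, arccos_le_pi _⟩, ?_⟩
    rw [cos_arccos (by linarith) (by linarith), show 2 + 2 * ((y - 2) / 2) = y by ring, ← hpe]
    have : 0 < 1 - (y - 2) / 2 := by linarith
    positivity

theorem chainW_catalanGen_pos (n : ℤ) (hn : -2 ≤ n) (t : ℝ) : 0 < chainW catalanGen n t := by
  unfold chainW
  split_ifs
  · omega
  · exact one_pos
  · exact derivHankelDet_catalanGen_pos _ _ _

/-! ### The determinants `w_n` in terms of path weights -/

lemma chainW_neg_three (f : ℝ → ℝ) (t : ℝ) : chainW f (-3) t = 0 := by simp [chainW]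
lemma chainW_neg_two (f : ℝ → ℝ) (t : ℝ) : chainW f (-2) t = 1 := by simp [chainW]
lemma chainW_neg_one (f : ℝ → ℝ) (t : ℝ) : chainW f (-1) t = 1 := by simp [chainW]

lemma chainW_natCast (f : ℝ → ℝ) (n : ℕ) (t : ℝ) :
    chainW f n t = derivHankelDet f (n % 2) (n / 2) t := by
  unfold chainW
  rw [if_neg (by omega), if_neg (by omega), Int.toNat_natCast]

lemma chainW_eq_prod {f : ℝ → ℝ} {t c : ℝ} {u : ℕ → ℝ} {n : ℕ}
    (h : ∀ m ≤ n, iteratedDeriv m f t = c * ballotArray u (2 * m) 0) :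
    chainW f n t = ∏ l ∈ Finset.range (n / 2 + 1), (c * weightProd u (2 * l + n % 2)) := by
  rw [chainW_natCast]
  exact hankel_det_eq (Nat.mod_lt _ two_pos) fun m hm => h m (by omega)

lemma chainW_eq_mul {f : ℝ → ℝ} {t c : ℝ} {u : ℕ → ℝ} {n : ℕ}
    (h : ∀ m ≤ n, iteratedDeriv m f t = c * ballotArray u (2 * m) 0) :
    chainW f n t = chainW f ((n : ℤ) - 2) t * (c * weightProd u n) := by
  rw [chainW_eq_prod h, Finset.prod_range_succ, show 2 * (n / 2) + n % 2 = n by omega]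
  congr 1
  -- For `n = 0, 1` the conventions `w_{-2} = w_{-1} = 1` play the role of the empty product.
  obtain _ | _ | n := n
  · simp [chainW]
  · simp [chainW]
  · rw [show ((n + 1 + 1 : ℕ) : ℤ) - 2 = (n : ℕ) by push_cast; ring,
      chainW_eq_prod fun m hm => h m (by omega), show (n + 1 + 1) / 2 = n / 2 + 1 by omega,
      show (n + 1 + 1) % 2 = n % 2 by omega]

/-! ### Construction of the Volterra solution -/

/-- The sequence determined by `u 0 = 0`, `u 1 = f' / f` and the Volterra chain. -/
noncomputable def volterraSeq (f : ℝ → ℝ) : ℕ → ℝ → ℝ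
  | 0 => fun _ => 0
  | 1 => fun t => deriv f t / f t
  | n + 2 => fun t => deriv (volterraSeq f (n + 1)) t / volterraSeq f (n + 1) t + volterraSeq f n t

lemma hasDerivAt_volterraSeq {f : ℝ → ℝ} {n : ℕ} {t : ℝ} (h0 : volterraSeq f (n + 1) t ≠ 0)
    (hd : DifferentiableAt ℝ (volterraSeq f (n + 1)) t) :
    HasDerivAt (volterraSeq f (n + 1))
      (volterraSeq f (n + 1) t * (volterraSeq f (n + 2) t - volterraSeq f n t)) t := by
  refine hd.hasDerivAt.congr_deriv ?_
  simp only [volterraSeq]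
  field_simp
  ring

lemma contDiff_volterraSeq {f : ℝ → ℝ} (hf : ContDiff ℝ ∞ f) (hf0 : ∀ t, f t ≠ 0) {N : ℕ}
    (h : ∀ n < N, (∀ t, volterraSeq f (n + 1) t ≠ 0)) (n : ℕ) (hn : n ≤ N + 1) :
    ContDiff ℝ ∞ (volterraSeq f n) := by
  induction n using Nat.strong_induction_on with
  | _ n ih =>
    obtain _ | _ | n := n
    · exact contDiff_const
    · exact hf.deriv'.div hf hf0
    · exact ((ih (n + 1) (by omega) (by omega)).deriv'.div
        (ih (n + 1) (by omega) (by omega)) (h n (by omega))).add (ih n (by omega) (by omega))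

lemma iteratedDeriv_eq_mul_ballotArray {f : ℝ → ℝ} (hf : ContDiff ℝ ∞ f) (hf0 : ∀ t, f t ≠ 0)
    {N : ℕ} (h : ∀ n < N, ∀ t, volterraSeq f (n + 1) t ≠ 0) (m : ℕ) (hm : m ≤ N + 1) :
    iteratedDeriv m f =
      fun t => f t * ballotArray (fun n => volterraSeq f n t) (2 * m) 0 := by
  induction m with
  | zero => simp [ballotArray]
  | succ m ih =>
    ext t
    rw [iteratedDeriv_succ, ih (by omega)]
    refine (hasDerivAt_mul_ballotArray (u := volterraSeq f) (N := N) (by simp [volterraSeq]) ?_ ?_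
      (by omega)).deriv
    · refine (hf.differentiable (by simp) t).hasDerivAt.congr_deriv ?_
      simp only [volterraSeq]
      field_simp [hf0 t]
    · exact fun n hn => hasDerivAt_volterraSeq (h n hn t)
        ((contDiff_volterraSeq hf hf0 h (n + 1) (by omega)).differentiable (by simp) t)

/-- Nonvanishing of `u₁, …, u_N` suffices for the path formula up to order `N + 1`, hence for
factoring `w_{N+1}`. As `u_{N+1}` is one of the factors, it cannot vanish and the induction
continues. -/
lemma volterraSeq_ne_zero {f : ℝ → ℝ} (hf : ContDiff ℝ ∞ f)
    (hW : ∀ n : ℕ, ∀ t, chainW f n t ≠ 0) (n : ℕ) (t : ℝ) : volterraSeq f (n + 1) t ≠ 0 := by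
  have hf0 : ∀ t, f t ≠ 0 := fun t => by simpa [chainW, derivHankelDet] using hW 0 t
  induction n using Nat.strong_induction_on generalizing t with
  | _ N ih =>
    have h := hW (N + 1) t
    rw [chainW_eq_mul (c := f t) (u := fun n => volterraSeq f n t) fun m hm => by
      rw [iteratedDeriv_eq_mul_ballotArray hf hf0 ih m hm], weightProd_succ] at h
    exact right_ne_zero_of_mul (right_ne_zero_of_mul (right_ne_zero_of_mul h))

lemma volterraSeq_eq_chainW {f : ℝ → ℝ} (hf : ContDiff ℝ ∞ f)
    (hW : ∀ n : ℤ, -2 ≤ n → ∀ t, chainW f n t ≠ 0) (n : ℕ) (t : ℝ) :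
    volterraSeq f n t = chainW f ((n : ℤ) - 3) t * chainW f (n : ℤ) t /
      (chainW f ((n : ℤ) - 2) t * chainW f ((n : ℤ) - 1) t) := by
  have hW' : ∀ n : ℕ, ∀ t, chainW f n t ≠ 0 := fun n => hW n (by omega)
  have hf0 : ∀ t, f t ≠ 0 := fun t => by simpa [chainW, derivHankelDet] using hW' 0 t
  have hrec : ∀ n : ℕ, chainW f n t = chainW f ((n : ℤ) - 2) t *
      (f t * weightProd (fun n => volterraSeq f n t) n) := fun n => chainW_eq_mul fun m _ => by
    rw [iteratedDeriv_eq_mul_ballotArray (N := m) hf hf0 (fun n _ => volterraSeq_ne_zero hf hW' n)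
      m (by omega)]
  obtain _ | n := n
  · simp [volterraSeq, chainW_neg_three]
  · have h1 := hrec n
    have h2 := hrec (n + 1)
    have h3 := hW ((n : ℤ) - 2) (by omega) t
    have h4 := hW ((n : ℤ) - 1) (by omega) t
    have h5 := hW' n t
    rw [weightProd_succ] at h2
    rw [show ((n + 1 : ℕ) : ℤ) - 3 = (n : ℤ) - 2 by push_cast; ring,
      show ((n + 1 : ℕ) : ℤ) - 1 = (n : ℤ) by push_cast; ring, h2,
      show ((n + 1 : ℕ) : ℤ) - 2 = (n : ℤ) - 1 by push_cast; ring, eq_div_iff (mul_ne_zero h4 h5)]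
    linear_combination volterraSeq f (n + 1) t * chainW f ((n : ℤ) - 1) t * h1

/-! ### The modified chain and the initial values -/

/-- The closed form of the solution of the modified chain. -/
noncomputable def modifiedSeq (f : ℝ → ℝ) (n : ℕ) (t : ℝ) : ℝ :=
  chainW f ((n : ℤ) - 3) t * chainW f ((n : ℤ) - 1) t / chainW f ((n : ℤ) - 2) t ^ 2

lemma modifiedSeq_zero (f : ℝ → ℝ) (t : ℝ) : modifiedSeq f 0 t = 0 := by
  simp [modifiedSeq, chainW_neg_three]

lemma modifiedSeq_one (f : ℝ → ℝ) : modifiedSeq f 1 = f := by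
  ext t
  simp [modifiedSeq, chainW, derivHankelDet]

lemma modifiedSeq_ne_zero {f : ℝ → ℝ} (hW : ∀ n : ℤ, -2 ≤ n → ∀ t, chainW f n t ≠ 0) (n : ℕ)
    (t : ℝ) : modifiedSeq f (n + 1) t ≠ 0 :=
  div_ne_zero (mul_ne_zero (hW _ (by omega) t) (hW _ (by omega) t))
    (pow_ne_zero 2 (hW _ (by omega) t))

lemma modifiedSeq_mul_succ {f : ℝ → ℝ} (hf : ContDiff ℝ ∞ f)
    (hW : ∀ n : ℤ, -2 ≤ n → ∀ t, chainW f n t ≠ 0) (n : ℕ) (t : ℝ) :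
    modifiedSeq f n t * modifiedSeq f (n + 1) t = volterraSeq f n t := by
  have h1 := hW ((n : ℤ) - 2) (by omega) t
  have h2 := hW ((n : ℤ) - 1) (by omega) t
  rw [volterraSeq_eq_chainW hf hW, modifiedSeq, modifiedSeq,
    show ((n + 1 : ℕ) : ℤ) - 3 = (n : ℤ) - 2 by push_cast; ring,
    show ((n + 1 : ℕ) : ℤ) - 2 = (n : ℤ) - 1 by push_cast; ring,
    show ((n + 1 : ℕ) : ℤ) - 1 = (n : ℤ) by push_cast; ring]
  field_simp

lemma hasDerivAt_volterraSeq_of_chainW_ne_zero {f : ℝ → ℝ} (hf : ContDiff ℝ ∞ f)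
    (hW : ∀ n : ℤ, -2 ≤ n → ∀ t, chainW f n t ≠ 0) (n : ℕ) (t : ℝ) :
    HasDerivAt (volterraSeq f (n + 1))
      (volterraSeq f (n + 1) t * (volterraSeq f (n + 2) t - volterraSeq f n t)) t := by
  have hW' : ∀ n : ℕ, ∀ t, chainW f n t ≠ 0 := fun n => hW n (by omega)
  have hf0 : ∀ t, f t ≠ 0 := fun t => by simpa [chainW, derivHankelDet] using hW' 0 t
  exact hasDerivAt_volterraSeq (volterraSeq_ne_zero hf hW' n t)
    ((contDiff_volterraSeq (N := n) hf hf0 (fun n _ => volterraSeq_ne_zero hf hW' n) (n + 1)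
      le_rfl).differentiable (by simp) t)

lemma hasDerivAt_modifiedSeq {f : ℝ → ℝ} (hf : ContDiff ℝ ∞ f)
    (hW : ∀ n : ℤ, -2 ≤ n → ∀ t, chainW f n t ≠ 0) (n : ℕ) (t : ℝ) :
    HasDerivAt (modifiedSeq f (n + 1))
      (modifiedSeq f (n + 1) t ^ 2 * (modifiedSeq f (n + 2) t - modifiedSeq f n t)) t := by
  induction n with
  | zero =>
    have h := modifiedSeq_mul_succ hf hW 1 t
    have h0 := modifiedSeq_ne_zero hW 0 t
    rw [zero_add, modifiedSeq_one] at h0 ⊢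
    refine (hf.differentiable (by simp) t).hasDerivAt.congr_deriv ?_
    simp only [volterraSeq, modifiedSeq_one, eq_div_iff h0] at h
    rw [modifiedSeq_zero, ← h]
    ring
  | succ n ih =>
    have h0 := modifiedSeq_ne_zero hW n
    -- Writing `v_{n+2} = u_{n+1} / v_{n+1}`, its logarithmic derivative is `u_{n+2} - u_n -
    -- v_{n+1}(v_{n+2} - v_n)`, and `u_n = v_n v_{n+1}` cancels.
    have heq : modifiedSeq f (n + 1 + 1) =
        volterraSeq f (n + 1) / modifiedSeq f (n + 1) := by
      ext x
      rw [Pi.div_apply, eq_div_iff (h0 x), mul_comm, modifiedSeq_mul_succ hf hW]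
    have h1 := modifiedSeq_mul_succ hf hW (n + 1) t
    have h2 := modifiedSeq_mul_succ hf hW (n + 2) t
    have h3 := modifiedSeq_mul_succ hf hW n t
    have := (hasDerivAt_volterraSeq_of_chainW_ne_zero hf hW n t).div ih (h0 t)
    rw [← heq] at this
    refine this.congr_deriv ?_
    rw [← h1, ← h2, ← h3]
    have := h0 t
    field_simp
    ring

lemma contDiff_catalanGen : ContDiff ℝ ∞ catalanGen := by
  refine contDiff_of_differentiable_iteratedDeriv fun m _ t => ?_
  rw [iteratedDeriv_catalanGen]
  exact (hasDerivAt_catalan_integral m t).differentiableAt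

lemma iteratedDeriv_catalanGen_zero (m : ℕ) : iteratedDeriv m catalanGen 0 = catalan m := by
  rw [iteratedDeriv_catalanGen]
  simpa using catalan_moment m

lemma chainW_catalanGen_zero (n : ℤ) (hn : -2 ≤ n) : chainW catalanGen n 0 = 1 := by
  have key : ∀ n : ℕ, chainW catalanGen n 0 = 1 := by
    intro n
    rw [chainW_eq_prod (c := 1) (u := fun _ => 1) fun m _ => by
      rw [iteratedDeriv_catalanGen_zero, ballotArray_one_eq_catalan, one_mul]]
    simp [weightProd]
  obtain h | h | h : n = -2 ∨ n = -1 ∨ 0 ≤ n := by omega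
  · rw [h, chainW_neg_two]
  · rw [h, chainW_neg_one]
  · lift n to ℕ using h
    exact key n

/-! ### Absolutely monotone functions and Bernstein's theorem -/

open Set in
lemma nonneg_of_hasDerivAt_nonneg {h h' : ℝ → ℝ} {x : ℝ} (hx : 0 ≤ x) (h0 : 0 ≤ h 0)
    (hd : ∀ y ∈ Icc 0 x, HasDerivAt h (h' y) y) (hn : ∀ y ∈ Icc 0 x, 0 ≤ h' y) : 0 ≤ h x := by
  have hmono : MonotoneOn h (Icc 0 x) := by
    refine monotoneOn_of_deriv_nonneg (convex_Icc 0 x)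
      (fun y hy => (hd y hy).continuousAt.continuousWithinAt)
      (fun y hy => (hd y (interior_subset hy)).differentiableAt.differentiableWithinAt)
      fun y hy => ?_
    rw [(hd y (interior_subset hy)).deriv]
    exact hn y (interior_subset hy)
  exact h0.trans (hmono ⟨le_rfl, hx⟩ ⟨hx, le_rfl⟩ hx)

/-- The remainder at `x` of the Taylor polynomial at `0` of degree less than `n` of `F m`, where
`F (m + k)` is thought of as the `k`-th derivative of `F m`. -/
noncomputable def taylorRemainder (F : ℕ → ℝ → ℝ) (n m : ℕ) (x : ℝ) : ℝ :=
  F m x - ∑ k ∈ Finset.range n, F (m + k) 0 / (k ! : ℝ) * x ^ k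

lemma taylorRemainder_zero (F : ℕ → ℝ → ℝ) (m : ℕ) (x : ℝ) : taylorRemainder F 0 m x = F m x := by
  simp [taylorRemainder]

lemma taylorRemainder_succ_apply_zero (F : ℕ → ℝ → ℝ) (n m : ℕ) :
    taylorRemainder F (n + 1) m 0 = 0 := by
  simp [taylorRemainder, Finset.sum_range_succ']

lemma hasDerivAt_taylorRemainder {F : ℕ → ℝ → ℝ} {x : ℝ}
    (hF : ∀ n, HasDerivAt (F n) (F (n + 1) x) x) (n m : ℕ) :
    HasDerivAt (taylorRemainder F (n + 1) m) (taylorRemainder F n (m + 1) x) x := by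
  have h : HasDerivAt (fun x => ∑ k ∈ Finset.range (n + 1), F (m + k) 0 / (k ! : ℝ) * x ^ k)
      (∑ k ∈ Finset.range n, F (m + 1 + k) 0 / (k ! : ℝ) * x ^ k) x := by
    simp only [Finset.sum_range_succ']
    refine HasDerivAt.congr_deriv (((HasDerivAt.fun_sum fun k _ =>
      (hasDerivAt_pow (k + 1) x).const_mul _)).add (by simpa using hasDerivAt_const x _))
      (Eq.trans (add_zero _) ?_)
    refine Finset.sum_congr rfl fun k _ => ?_
    rw [show m + (k + 1) = m + 1 + k by ring, Nat.factorial_succ]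
    push_cast
    field_simp
  exact (hF m).sub h

section AbsolutelyMonotone

open Set

variable {I : Set ℝ} {F : ℕ → ℝ → ℝ}

/-- This inequality says that the remainder divided by `x ^ (n + 1)` is nondecreasing.
Differentiating the difference of the two sides lowers `n` and raises `m`, down to `x F_{m+2} ≥ 0`.
-/
lemma mul_taylorRemainder_le (hI : I.OrdConnected) (h0 : (0 : ℝ) ∈ I)
    (hF : ∀ n, ∀ x ∈ I, HasDerivAt (F n) (F (n + 1) x) x) (hpos : ∀ n, ∀ x ∈ I, 0 ≤ F n x)
    (n m : ℕ) {x : ℝ} (hx : x ∈ I) (hx0 : 0 ≤ x) :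
    (n + 1) * taylorRemainder F (n + 1) m x ≤ x * taylorRemainder F n (m + 1) x := by
  have hsub : ∀ {x}, x ∈ I → Icc 0 x ⊆ I := fun hx => hI.out h0 hx
  induction n generalizing m x with
  | zero =>
    refine sub_nonneg.1 (nonneg_of_hasDerivAt_nonneg
      (h := fun x => x * taylorRemainder F 0 (m + 1) x - ((0 : ℕ) + 1) * taylorRemainder F 1 m x)
      (h' := fun x => x * F (m + 2) x) hx0
      (by simp [taylorRemainder_succ_apply_zero]) (fun y hy => ?_)
      fun y hy => mul_nonneg hy.1 (hpos _ y (hsub hx hy)))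
    have h1 : HasDerivAt (taylorRemainder F 0 (m + 1)) (F (m + 2) y) y := by
      rw [show taylorRemainder F 0 (m + 1) = F (m + 1) from funext (taylorRemainder_zero F _)]
      exact hF (m + 1) y (hsub hx hy)
    refine (((hasDerivAt_id y).mul h1).sub ((hasDerivAt_taylorRemainder
      (fun n => hF n y (hsub hx hy)) 0 m).const_mul _)).congr_deriv ?_
    simp
  | succ n ih =>
    refine sub_nonneg.1 (nonneg_of_hasDerivAt_nonneg
      (h := fun x => x * taylorRemainder F (n + 1) (m + 1) x -
        ((n + 1 : ℕ) + 1) * taylorRemainder F (n + 1 + 1) m x)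
      (h' := fun x => x * taylorRemainder F n (m + 2) x -
        (n + 1) * taylorRemainder F (n + 1) (m + 1) x) hx0
      (by simp [taylorRemainder_succ_apply_zero]) (fun y hy => ?_)
      fun y hy => sub_nonneg.2 (ih (m + 1) (hsub hx hy) hy.1))
    have h1 := hasDerivAt_taylorRemainder (fun n => hF n y (hsub hx hy)) n (m + 1)
    refine (((hasDerivAt_id y).mul h1).sub ((hasDerivAt_taylorRemainder
      (fun n => hF n y (hsub hx hy)) (n + 1) m).const_mul _)).congr_deriv ?_
    simp only [id]
    push_cast
    ring

lemma taylorRemainder_nonneg (hI : I.OrdConnected) (h0 : (0 : ℝ) ∈ I)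
    (hF : ∀ n, ∀ x ∈ I, HasDerivAt (F n) (F (n + 1) x) x) (hpos : ∀ n, ∀ x ∈ I, 0 ≤ F n x)
    (n m : ℕ) {x : ℝ} (hx : x ∈ I) (hx0 : 0 ≤ x) : 0 ≤ taylorRemainder F n m x := by
  induction n generalizing m x with
  | zero => rw [taylorRemainder_zero]; exact hpos m x hx
  | succ n ih =>
    exact nonneg_of_hasDerivAt_nonneg hx0 (taylorRemainder_succ_apply_zero F n m).ge
      (fun y hy => hasDerivAt_taylorRemainder (fun n => hF n y (hI.out h0 hx hy)) n m)
      fun y hy => ih (m + 1) (hI.out h0 hx hy) hy.1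

lemma taylorRemainder_le_pow_mul (hI : I.OrdConnected) (h0 : (0 : ℝ) ∈ I)
    (hF : ∀ n, ∀ x ∈ I, HasDerivAt (F n) (F (n + 1) x) x) (hpos : ∀ n, ∀ x ∈ I, 0 ≤ F n x)
    (n m : ℕ) {x b : ℝ} (hb : b ∈ I) (hx0 : 0 < x) (hxb : x ≤ b) :
    taylorRemainder F (n + 1) m x ≤ (x / b) ^ (n + 1) * taylorRemainder F (n + 1) m b := by
  have hsub : Icc x b ⊆ I := fun y hy => hI.out h0 hb ⟨hx0.le.trans hy.1, hy.2⟩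
  have hd : ∀ y ∈ Icc x b, HasDerivAt (fun y => taylorRemainder F (n + 1) m y / y ^ (n + 1))
      ((y * taylorRemainder F n (m + 1) y - (n + 1) * taylorRemainder F (n + 1) m y) /
        y ^ (n + 2)) y := by
    intro y hy
    have hy0 : 0 < y := hx0.trans_le hy.1
    refine ((hasDerivAt_taylorRemainder (fun n => hF n y (hsub hy)) n m).div
      (hasDerivAt_pow (n + 1) y) (by positivity)).congr_deriv ?_
    push_cast
    field_simp
    ring
  have hmono : MonotoneOn (fun y => taylorRemainder F (n + 1) m y / y ^ (n + 1)) (Icc x b) := by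
    refine monotoneOn_of_deriv_nonneg (convex_Icc x b)
      (fun y hy => (hd y hy).continuousAt.continuousWithinAt)
      (fun y hy => (hd y (interior_subset hy)).differentiableAt.differentiableWithinAt)
      fun y hy => ?_
    have hy' := interior_subset hy
    have hy0 : 0 < y := hx0.trans_le hy'.1
    rw [(hd y hy').deriv]
    exact div_nonneg (sub_nonneg.2 (mul_taylorRemainder_le hI h0 hF hpos n m (hsub hy') hy0.le))
      (by positivity)
  have := hmono ⟨le_rfl, hxb⟩ ⟨hxb, le_rfl⟩ hxb
  simp only at this
  rw [div_le_iff₀ (by positivity)] at this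
  refine this.trans_eq ?_
  rw [div_pow]
  ring

/-- To the left of `0` the remainders alternate in sign and are bounded by the first omitted term;
both claims follow by integrating the case of lower order. -/
lemma taylorRemainder_neg_bounds (hI : I.OrdConnected) (h0 : (0 : ℝ) ∈ I)
    (hF : ∀ n, ∀ x ∈ I, HasDerivAt (F n) (F (n + 1) x) x) (hpos : ∀ n, ∀ x ∈ I, 0 ≤ F n x)
    (n m : ℕ) {y : ℝ} (hy : -y ∈ I) (hy0 : 0 ≤ y) :
    0 ≤ (-1) ^ n * taylorRemainder F n m (-y) ∧
      (-1) ^ n * taylorRemainder F n m (-y) ≤ F (m + n) 0 / (n ! : ℝ) * y ^ n := by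
  have hsub : ∀ {y}, -y ∈ I → ∀ z ∈ Icc 0 y, -z ∈ I := fun hy z hz =>
    hI.out hy h0 ⟨neg_le_neg hz.2, neg_nonpos.2 hz.1⟩
  induction n generalizing m y with
  | zero =>
    simp only [pow_zero, one_mul, taylorRemainder_zero, add_zero, Nat.factorial_zero, Nat.cast_one,
      div_one, mul_one]
    refine ⟨hpos m _ hy, sub_nonneg.1 (nonneg_of_hasDerivAt_nonneg
      (h := fun y => F m 0 - F m (-y)) (h' := fun y => F (m + 1) (-y)) hy0 (by simp)
      (fun z hz => ?_) fun z hz => hpos _ _ (hsub hy z hz))⟩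
    simpa [Function.comp_def] using
      ((hF m (-z) (hsub hy z hz)).scomp z (hasDerivAt_neg z)).const_sub (F m 0)
  | succ n ih =>
    have hd : ∀ z ∈ Icc 0 y, HasDerivAt (fun z => (-1) ^ (n + 1) * taylorRemainder F (n + 1) m (-z))
        ((-1) ^ n * taylorRemainder F n (m + 1) (-z)) z := by
      intro z hz
      refine (((hasDerivAt_taylorRemainder (fun n => hF n (-z) (hsub hy z hz)) n m).scomp z
        (hasDerivAt_neg z)).const_mul ((-1) ^ (n + 1))).congr_deriv ?_
      simp only [smul_eq_mul]
      ring
    refine ⟨nonneg_of_hasDerivAt_nonneg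
      (h := fun y => (-1) ^ (n + 1) * taylorRemainder F (n + 1) m (-y)) hy0
      (by simp [taylorRemainder_succ_apply_zero]) hd
      fun z hz => (ih (m + 1) (hsub hy z hz) hz.1).1, sub_nonneg.1 (nonneg_of_hasDerivAt_nonneg
        (h := fun y => F (m + (n + 1)) 0 / ((n + 1)! : ℝ) * y ^ (n + 1) -
          (-1) ^ (n + 1) * taylorRemainder F (n + 1) m (-y))
        (h' := fun z => F (m + 1 + n) 0 / (n ! : ℝ) * z ^ n -
          (-1) ^ n * taylorRemainder F n (m + 1) (-z)) hy0
        (by simp [taylorRemainder_succ_apply_zero]) (fun z hz => ?_)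
        fun z hz => sub_nonneg.2 (ih (m + 1) (hsub hy z hz) hz.1).2)⟩
    refine (((hasDerivAt_pow (n + 1) z).const_mul _).sub (hd z hz)).congr_deriv ?_
    rw [show m + (n + 1) = m + 1 + n by ring, Nat.factorial_succ, Nat.add_sub_cancel]
    push_cast
    field_simp

open Filter Topology in
/-- A form of Bernstein's theorem: an absolutely monotone function is the sum of its Taylor
series at `0`. -/
theorem eq_of_hasSum_of_absolutelyMonotone (hIo : IsOpen I) (hI : I.OrdConnected) (h0 : (0 : ℝ) ∈ I)
    (hF : ∀ n, ∀ x ∈ I, HasDerivAt (F n) (F (n + 1) x) x) (hpos : ∀ n, ∀ x ∈ I, 0 ≤ F n x)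
    {C : ℝ} (hC : ∀ n, F n 0 ≤ C ^ n) {t : ℝ} (ht : t ∈ I) {s : ℝ}
    (hs : HasSum (fun n => F n 0 / (n ! : ℝ) * t ^ n) s) : F 0 t = s := by
  suffices h : Tendsto (fun n => taylorRemainder F (n + 1) 0 t) atTop (𝓝 0) by
    have h1 := (hs.tendsto_sum_nat.comp (tendsto_add_atTop_nat 1))
    have h2 := h.const_sub (F 0 t)
    rw [sub_zero] at h2
    refine tendsto_nhds_unique h2 (h1.congr fun n => ?_)
    simp [taylorRemainder]
  obtain ht0 | rfl | ht0 := lt_trichotomy t 0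
  · have hb := fun n => taylorRemainder_neg_bounds hI h0 hF hpos n 0 (y := -t) (by simpa)
      (by linarith)
    simp only [neg_neg] at hb
    have hlim : Tendsto (fun n : ℕ => (C * -t) ^ (n + 1) / ((n + 1) ! : ℝ)) atTop (𝓝 0) :=
      (FloorSemiring.tendsto_pow_div_factorial_atTop (C * -t)).comp (tendsto_add_atTop_nat 1)
    refine squeeze_zero_norm (fun n => ?_) hlim
    have h1 := hb (n + 1)
    have h2 : ‖taylorRemainder F (n + 1) 0 t‖ = (-1) ^ (n + 1) * taylorRemainder F (n + 1) 0 t := by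
      rw [← Real.norm_of_nonneg h1.1, norm_mul]
      simp
    rw [h2]
    refine h1.2.trans ?_
    rw [mul_pow, zero_add, div_mul_eq_mul_div]
    have : 0 ≤ -t := by linarith
    gcongr
    exact hC _
  · simp [taylorRemainder_succ_apply_zero]
  -- The derivatives at `t > 0` have no a priori bound. Instead, room to the right gives a remainder
  -- of at most `(t / b) ^ (n + 1) * F 0 b`.
  · obtain ⟨b, hb, htb⟩ : ∃ b ∈ I, t < b := by
      obtain ⟨ε, hε, h⟩ := Metric.isOpen_iff.1 hIo t ht
      refine ⟨t + ε / 2, h ?_, by linarith⟩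
      rw [Metric.mem_ball, Real.dist_eq, add_sub_cancel_left, abs_of_pos (by positivity)]
      linarith
    have hb0 : 0 < b := ht0.trans htb
    have hlim : Tendsto (fun n : ℕ => (t / b) ^ (n + 1) * F 0 b) atTop (𝓝 0) := by
      have := ((tendsto_pow_atTop_nhds_zero_of_lt_one (by positivity)
        ((div_lt_one hb0).2 htb)).comp (tendsto_add_atTop_nat 1)).mul_const (F 0 b)
      rwa [zero_mul] at this
    refine squeeze_zero (fun n => taylorRemainder_nonneg hI h0 hF hpos (n + 1) 0 ht ht0.le)
      (fun n => (taylorRemainder_le_pow_mul hI h0 hF hpos n 0 hb ht0 htb.le).trans ?_) hlim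
    gcongr
    refine sub_le_self _ (Finset.sum_nonneg fun k _ => ?_)
    have := hpos (0 + k) 0 h0
    positivity

end AbsolutelyMonotone

/-! ### Scalar linear equations -/

lemma exists_exp_primitive {I : Set ℝ} (hIo : IsOpen I) (hI : I.OrdConnected) (h0 : (0 : ℝ) ∈ I)
    {a : ℝ → ℝ} (ha : ContinuousOn a I) :
    ∃ E : ℝ → ℝ, E 0 = 1 ∧ (∀ t, 0 < E t) ∧ ∀ t ∈ I, HasDerivAt E (E t * a t) t := by
  refine ⟨fun t => Real.exp (∫ s in (0 : ℝ)..t, a s), by simp, fun t => Real.exp_pos _,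
    fun t ht => ?_⟩
  refine (intervalIntegral.integral_hasDerivAt_right ?_ ?_ (ha.continuousAt (hIo.mem_nhds ht))).exp
  · exact (ha.mono (hI.uIcc_subset h0 ht)).intervalIntegrable
  · exact ha.stronglyMeasurableAtFilter hIo t ht

lemma eq_mul_of_linear_ode {I : Set ℝ} (hIo : IsOpen I) (hI : I.OrdConnected) (h0 : (0 : ℝ) ∈ I)
    {a y E : ℝ → ℝ} (hE0 : E 0 = 1) (hEpos : ∀ t, 0 < E t)
    (hE : ∀ t ∈ I, HasDerivAt E (E t * a t) t) (hy : ∀ t ∈ I, HasDerivAt y (y t * a t) t)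
    {t : ℝ} (ht : t ∈ I) : y t = y 0 * E t := by
  have hd : ∀ t ∈ I, HasDerivAt (fun t => y t / E t) 0 t := fun t ht => by
    refine ((hy t ht).div (hE t ht) (hEpos t).ne').congr_deriv ?_
    ring
  have := hIo.is_const_of_deriv_eq_zero hI.isPreconnected
    (fun t ht => (hd t ht).differentiableAt.differentiableWithinAt) (fun t ht => (hd t ht).deriv)
    ht h0
  simp only [hE0, div_one] at this
  rw [← this, div_mul_cancel₀ _ (hEpos t).ne']

lemma catalan_le_four_pow (n : ℕ) : catalan n ≤ 4 ^ n := by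
  have h := succ_mul_catalan_eq_centralBinom n
  have h2 := Nat.centralBinom_le_four_pow n
  nlinarith [Nat.zero_le (n * catalan n)]

/-! ### Uniqueness for both chains -/

section Chain

variable {I : Set ℝ}

lemma IsVolterraSolution.zero_eq_zero {u : ℕ → ℝ → ℝ} (hIo : IsOpen I) (hI : I.OrdConnected)
    (h0 : (0 : ℝ) ∈ I) (hu : IsVolterraSolution I u) (hu0 : u 0 0 = 0) {t : ℝ} (ht : t ∈ I) :
    u 0 t = 0 := by
  obtain ⟨⟨g, hg, hug⟩, hu⟩ := hu
  obtain ⟨E, hE0, hEpos, hE⟩ := exists_exp_primitive hIo hI h0 (a := fun t => u 1 t - g t)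
    (ContinuousOn.sub (fun t ht => (hu 0 t ht).continuousAt.continuousWithinAt) hg)
  rw [eq_mul_of_linear_ode hIo hI h0 hE0 hEpos hE hug ht, hu0, zero_mul]

lemma IsModifiedVolterraSolution.zero_eq_zero {v : ℕ → ℝ → ℝ} (hIo : IsOpen I)
    (hI : I.OrdConnected) (h0 : (0 : ℝ) ∈ I) (hv : IsModifiedVolterraSolution I v)
    (hv0 : v 0 0 = 0) {t : ℝ} (ht : t ∈ I) : v 0 t = 0 := by
  obtain ⟨⟨g, hg, hvg⟩, hv⟩ := hv
  -- The quadratic equation is read as a linear one by absorbing one factor `v 0` into the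
  -- continuous coefficient.
  obtain ⟨E, hE0, hEpos, hE⟩ := exists_exp_primitive hIo hI h0
    (a := fun t => v 0 t * (v 1 t - g t))
    (ContinuousOn.mul (fun t ht => (hvg t ht).continuousAt.continuousWithinAt)
      (ContinuousOn.sub (fun t ht => (hv 0 t ht).continuousAt.continuousWithinAt) hg))
  rw [eq_mul_of_linear_ode hIo hI h0 hE0 hEpos hE
    (fun t ht => (hvg t ht).congr_deriv (by ring)) ht, hv0, zero_mul]

lemma IsVolterraSolution.pos {u : ℕ → ℝ → ℝ} (hIo : IsOpen I) (hI : I.OrdConnected)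
    (h0 : (0 : ℝ) ∈ I) (hu : IsVolterraSolution I u) (hu0 : HasStepInitialData u) (n : ℕ) {t : ℝ}
    (ht : t ∈ I) : 0 < u (n + 1) t := by
  have hc : ContinuousOn (u n) I := by
    obtain _ | n := n
    · obtain ⟨g, hg, hug⟩ := hu.1
      exact fun t ht => (hug t ht).continuousAt.continuousWithinAt
    · exact fun t ht => (hu.2 n t ht).continuousAt.continuousWithinAt
  obtain ⟨E, hE0, hEpos, hE⟩ := exists_exp_primitive hIo hI h0 (a := fun t => u (n + 2) t - u n t)
    (ContinuousOn.sub (fun t ht => (hu.2 (n + 1) t ht).continuousAt.continuousWithinAt) hc)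
  rw [eq_mul_of_linear_ode hIo hI h0 hE0 hEpos hE (hu.2 n) ht, hu0.2 (n + 1) (by omega), one_mul]
  exact hEpos t

theorem IsVolterraSolution.eq_volterraSeq {u : ℕ → ℝ → ℝ} (hIo : IsOpen I) (hI : I.OrdConnected)
    (h0 : (0 : ℝ) ∈ I) (hu : IsVolterraSolution I u) (hu0 : HasStepInitialData u) (n : ℕ) {t : ℝ}
    (ht : t ∈ I) : u n t = volterraSeq catalanGen n t := by
  obtain ⟨f, hf0, hfpos, hf⟩ := exists_exp_primitive hIo hI h0 (a := u 1)
    (fun t ht => (hu.2 0 t ht).continuousAt.continuousWithinAt)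
  have hf' : ∀ t ∈ I, f t = catalanGen t := by
    intro t ht
    have hF0 : ∀ n, f 0 * ballotArray (fun n => u n 0) (2 * n) 0 = catalan n := by
      intro n
      rw [hf0, one_mul, ballotArray_congr (v := fun _ => 1) (fun n => hu0.2 (n + 1) (by omega)),
        ballotArray_one_eq_catalan]
    -- The derivatives of `f` are path counts with positive weights, hence nonnegative; `c_n ≤ 4ⁿ`
    -- supplies the growth bound.
    have := eq_of_hasSum_of_absolutelyMonotone (C := 4)
      (F := fun n t => f t * ballotArray (fun n => u n t) (2 * n) 0) hIo hI h0
      (fun n t ht => hasDerivAt_mul_ballotArray (hu.zero_eq_zero hIo hI h0 hu0.1 ht)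
        (hf t ht) (fun m _ => hu.2 m t ht) le_rfl)
      (fun n t ht => mul_nonneg (hfpos t).le
        (ballotArray_nonneg (fun n => (hu.pos hIo hI h0 hu0 n ht).le) _ _))
      (fun n => by simpa only [hF0] using mod_cast catalan_le_four_pow n) ht
      (s := catalanGen t) (by simpa only [hF0] using hasSum_catalanGen t)
    simpa [ballotArray] using this
  induction n using Nat.strong_induction_on generalizing t with
  | _ n ih =>
    obtain _ | _ | n := n
    · simpa [volterraSeq] using hu.zero_eq_zero hIo hI h0 hu0.1 ht
    · have h1 : deriv catalanGen t = f t * u 1 t := by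
        rw [← (hf t ht).deriv]
        exact (Filter.eventuallyEq_of_mem (hIo.mem_nhds ht) fun s hs => (hf' s hs).symm).deriv_eq
      simp only [volterraSeq]
      rw [h1, ← hf' t ht, mul_div_cancel_left₀ _ (hfpos t).ne', zero_add]
    · have h1 : deriv (volterraSeq catalanGen (n + 1)) t = u (n + 1) t * (u (n + 2) t - u n t) := by
        rw [← (hu.2 n t ht).deriv]
        exact (Filter.eventuallyEq_of_mem (hIo.mem_nhds ht) fun s hs =>
          (ih (n + 1) (by omega) hs).symm).deriv_eq
      simp only [volterraSeq]
      rw [h1, ← ih n (by omega) ht, ← ih (n + 1) (by omega) ht,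
        mul_div_cancel_left₀ _ (hu.pos hIo hI h0 hu0 n ht).ne']
      ring

lemma chainW_catalanGen_ne_zero (n : ℤ) (hn : -2 ≤ n) (t : ℝ) : chainW catalanGen n t ≠ 0 :=
  (chainW_catalanGen_pos n hn t).ne'

theorem IsModifiedVolterraSolution.eq_modifiedSeq {v : ℕ → ℝ → ℝ} (hIo : IsOpen I)
    (hI : I.OrdConnected) (h0 : (0 : ℝ) ∈ I) (hv : IsModifiedVolterraSolution I v)
    (hv0 : HasStepInitialData v) (n : ℕ) {t : ℝ} (ht : t ∈ I) :
    v n t = modifiedSeq catalanGen n t := by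
  have hz : ∀ t ∈ I, v 0 t = 0 := fun t ht => hv.zero_eq_zero hIo hI h0 hv0.1 ht
  -- The products `v_n v_{n+1}` solve the Volterra chain; since the zeroth one is identically `0`,
  -- its fictitious neighbour may be taken to be `0`.
  have hu : IsVolterraSolution I fun n t => v n t * v (n + 1) t := by
    refine ⟨⟨0, continuousOn_const, fun t ht => ?_⟩, fun n t ht => ?_⟩
    · simp only [hz t ht, zero_mul]
      exact (hasDerivAt_const t (0 : ℝ)).congr_of_eventuallyEq
        (Filter.eventuallyEq_of_mem (hIo.mem_nhds ht) fun s hs => by simp [hz s hs])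
    · refine ((hv.2 n t ht).mul (hv.2 (n + 1) t ht)).congr_deriv ?_
      simp only [add_assoc, Nat.reduceAdd]
      ring
  have hu0 : HasStepInitialData fun n t => v n t * v (n + 1) t :=
    ⟨by simp [hv0.1], fun n hn => by simp [hv0.2 n hn, hv0.2 (n + 1) (by omega)]⟩
  have huv : ∀ n, ∀ t ∈ I, v n t * v (n + 1) t = volterraSeq catalanGen n t :=
    fun n t ht => hu.eq_volterraSeq hIo hI h0 hu0 n ht
  induction n generalizing t with
  | zero => rw [hz t ht, modifiedSeq_zero]
  | succ n ih =>
    obtain _ | n := n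
    -- As `v₀ = 0`, both `v₁` and `f` satisfy `y' = y u₁` with value `1` at `0`. The later `v_n`
    -- follow by dividing `u_n = v_n v_{n+1}` by a known nonzero factor.
    · have hlin : ∀ t ∈ I, HasDerivAt (v 1) (v 1 t * volterraSeq catalanGen 1 t) t := by
        intro t ht
        refine (hv.2 0 t ht).congr_deriv ?_
        rw [← huv 1 t ht, hz t ht, sub_zero]
        ring
      have hpos : ∀ t, 0 < catalanGen t := fun t => by
        simpa [chainW, derivHankelDet] using chainW_catalanGen_pos 0 (by omega) t
      have hc0 : catalanGen 0 = 1 := by simpa using iteratedDeriv_catalanGen_zero 0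
      rw [modifiedSeq_one, eq_mul_of_linear_ode hIo hI h0 hc0 hpos (fun t _ => ?_) hlin ht,
        hv0.2 1 le_rfl, one_mul]
      refine (contDiff_catalanGen.differentiable (by simp) t).hasDerivAt.congr_deriv ?_
      have := (hpos t).ne'
      simp only [volterraSeq]
      field_simp
    · have h1 := modifiedSeq_mul_succ contDiff_catalanGen chainW_catalanGen_ne_zero (n + 1) t
      rw [← huv (n + 1) t ht, ih ht] at h1
      exact (mul_left_cancel₀ (modifiedSeq_ne_zero chainW_catalanGen_ne_zero n t) h1).symm

lemma isVolterraSolution_of_eqOn {u : ℕ → ℝ → ℝ} (hIo : IsOpen I) (h0 : (0 : ℝ) ∈ I)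
    (hu : ∀ n, ∀ t ∈ I, u n t = volterraSeq catalanGen n t) :
    IsVolterraSolution I u ∧ HasStepInitialData u := by
  refine ⟨⟨⟨0, continuousOn_const, fun t ht => ?_⟩, fun n t ht => ?_⟩, ?_, fun n hn => ?_⟩
  · rw [hu 0 t ht, volterraSeq, zero_mul]
    exact (hasDerivAt_const t (0 : ℝ)).congr_of_eventuallyEq
      (Filter.eventuallyEq_of_mem (hIo.mem_nhds ht) fun s hs => hu 0 s hs)
  · rw [hu _ t ht, hu _ t ht, hu _ t ht]
    exact (hasDerivAt_volterraSeq_of_chainW_ne_zero contDiff_catalanGen chainW_catalanGen_ne_zero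
      n t).congr_of_eventuallyEq
        (Filter.eventuallyEq_of_mem (hIo.mem_nhds ht) fun s hs => hu _ s hs)
  · rw [hu 0 0 h0, volterraSeq]
  · rw [hu n 0 h0, volterraSeq_eq_chainW contDiff_catalanGen chainW_catalanGen_ne_zero,
      chainW_catalanGen_zero _ (by omega), chainW_catalanGen_zero _ (by omega),
      chainW_catalanGen_zero _ (by omega), chainW_catalanGen_zero _ (by omega)]
    norm_num

lemma isModifiedVolterraSolution_of_eqOn {v : ℕ → ℝ → ℝ} (hIo : IsOpen I) (h0 : (0 : ℝ) ∈ I)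
    (hv : ∀ n, ∀ t ∈ I, v n t = modifiedSeq catalanGen n t) :
    IsModifiedVolterraSolution I v ∧ HasStepInitialData v := by
  refine ⟨⟨⟨0, continuousOn_const, fun t ht => ?_⟩, fun n t ht => ?_⟩, ?_, fun n hn => ?_⟩
  · rw [hv 0 t ht, modifiedSeq_zero, zero_pow two_ne_zero, zero_mul]
    exact (hasDerivAt_const t (0 : ℝ)).congr_of_eventuallyEq
      (Filter.eventuallyEq_of_mem (hIo.mem_nhds ht) fun s hs => by
        simp [hv 0 s hs, modifiedSeq_zero])
  · rw [hv _ t ht, hv _ t ht, hv _ t ht]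
    exact (hasDerivAt_modifiedSeq contDiff_catalanGen chainW_catalanGen_ne_zero
      n t).congr_of_eventuallyEq
        (Filter.eventuallyEq_of_mem (hIo.mem_nhds ht) fun s hs => hv _ s hs)
  · rw [hv 0 0 h0, modifiedSeq_zero]
  · rw [hv n 0 h0, modifiedSeq, chainW_catalanGen_zero _ (by omega),
      chainW_catalanGen_zero _ (by omega), chainW_catalanGen_zero _ (by omega)]
    norm_num

end Chain

theorem mainTheorem1 :
    -- `I₀` is the unique solution of its Cauchy problem
    (∀ y : ℝ → ℝ, SolvesBesselCauchy y ↔ y = besselI0) ∧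
    -- `f` is the exponential generating function of the Catalan numbers
    (∀ t : ℝ, HasSum (fun n : ℕ => (catalan n : ℝ) / (n ! : ℝ) * t ^ n) (catalanGen t)) ∧
    -- the denominators in the formulas do not vanish
    (∀ n : ℤ, -2 ≤ n → ∀ t : ℝ, chainW catalanGen n t ≠ 0) ∧
    -- on every open interval containing `0`, each Cauchy problem has exactly one solution,
    -- and it is given by the formulas
    ∀ I : Set ℝ, IsOpen I → I.OrdConnected → (0 : ℝ) ∈ I →
      (∀ v : ℕ → ℝ → ℝ,
        (IsModifiedVolterraSolution I v ∧ HasStepInitialData v) ↔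
          ∀ n : ℕ, ∀ t ∈ I,
            v n t = chainW catalanGen ((n : ℤ) - 3) t * chainW catalanGen ((n : ℤ) - 1) t /
              chainW catalanGen ((n : ℤ) - 2) t ^ 2) ∧
      (∀ u : ℕ → ℝ → ℝ,
        (IsVolterraSolution I u ∧ HasStepInitialData u) ↔
          ∀ n : ℕ, ∀ t ∈ I,
            u n t = chainW catalanGen ((n : ℤ) - 3) t * chainW catalanGen (n : ℤ) t /
              (chainW catalanGen ((n : ℤ) - 2) t * chainW catalanGen ((n : ℤ) - 1) t)) := by
  refine ⟨solvesBesselCauchy_iff, hasSum_catalanGen, chainW_catalanGen_ne_zero,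
    fun I hIo hI h0 => ⟨fun v => ⟨fun ⟨hv, hv0⟩ n t ht => hv.eq_modifiedSeq hIo hI h0 hv0 n ht,
      isModifiedVolterraSolution_of_eqOn hIo h0⟩, fun u => ?_⟩⟩
  simp only [← volterraSeq_eq_chainW contDiff_catalanGen chainW_catalanGen_ne_zero]
  exact ⟨fun ⟨hu, hu0⟩ n t ht => hu.eq_volterraSeq hIo hI h0 hu0 n ht,
    isVolterraSolution_of_eqOn hIo h0⟩
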